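/- **Proposition 5.2.** Let $V$ be a finite-dimensional real inner product space and let $G$ be a reflection group on $V$, i.e. a finite group of orthogonal transformations of $V$ generated by reflections in linear hyperplanes. Assume that $G$ is irreducible (it is not the internal direct product of two nontrivial subgroups that are themselves reflection groups on $V$) and essential (it fixes no nonzero vector). Let $\mathcal H(G)$ be the set of reflection hyperplanes of $G$, i.e. the fixed hyperplanes of the reflections in $G$. A flat is an intersection of members of $\mathcal H(G)$ (the empty intersection being $V$), and $\mathcal H_i$ denotes the set of points of $V$ that lie in some flat of dimension $i$. The roots of $G$ are the unit normal vectors of its reflection hyperplanes. A simple system is a linearly independent set $\Delta$ of roots such that every root is a linear combination of $\Delta$ with all coefficients $\ge 0$ or all coefficients $\le 0$. The Dynkin diagram $D$ of $G$ is the labelled graph with node set $\Delta$ in which distinct $\alpha,\beta$ carry the label $m(\alpha,\beta)=$ the order of $s_\alpha s_\beta$, and are joined by an edge exactly when $m(\alpha,\beta)\ge 3$ ($s_\alpha$ is the reflection in $\alpha^\perp$). A subdiagram consists of a subset of the nodes together with all edges and labels between them. A parabolic subgroup of $G$ is a subgroup generated by $\{s_\alpha:\alpha\in I\}$ for a subset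 $I$ of some simple system of $G$. A subgroup has Dynkin diagram $D'$ if its diagram is isomorphic to $D'$ as a labelled graph. For a reflection group $W$ on $V$, a point $p\in V$ is $W$-general if it lies on no reflection hyperplane of $W$. Let $k\ge 1$, let $p\in\mathcal H_k\setminus\mathcal H_{k-1}$, and let $D'\subseteq D$ be a connected subdiagram on $k$ nodes. Then there is a parabolic subgroup $W\subseteq G$ with Dynkin diagram $D'$ such that $p$ is $W$-general. -/

import Mathlib

/-!
Finite real reflection groups on a Euclidean space `V`, their reflection arrangements and strata,
simple systems, Dynkin diagrams (as labelled graphs, encoded by Coxeter matrices) and parabolic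
subgroups.
-/

noncomputable section

namespace ReflGroup

section Groups

variable {V : Type*} [NormedAddCommGroup V] [InnerProductSpace ℝ V]

/-- The linear hyperplane orthogonal to `α` (for `α ≠ 0`). -/
def hyperplane (α : V) : Submodule ℝ V := (Submodule.span ℝ {α})ᗮ

/-- The orthogonal reflection of `V` in the hyperplane orthogonal to `α`. -/
def refl (α : V) : V ≃ₗᵢ[ℝ] V := ((Submodule.span ℝ {α})ᗮ).reflection

/-- The roots of `G`: the unit normal vectors of the reflections contained in `G`. -/
def roots (G : Subgroup (V ≃ₗᵢ[ℝ] V)) : Set V := {α | ‖α‖ = 1 ∧ refl α ∈ G}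

/-- A (real) reflection group: a finite group of orthogonal transformations of `V` that is
generated by the reflections it contains. The trivial group is one. -/
def IsReflectionGroup (G : Subgroup (V ≃ₗᵢ[ℝ] V)) : Prop :=
  (G : Set (V ≃ₗᵢ[ℝ] V)).Finite ∧ G = Subgroup.closure (refl '' roots G)

/-- `G` is not the (internal direct) product of two nontrivial reflection groups. -/
def IsIrreducible (G : Subgroup (V ≃ₗᵢ[ℝ] V)) : Prop :=
  ¬ ∃ G₁ G₂ : Subgroup (V ≃ₗᵢ[ℝ] V),
      IsReflectionGroup G₁ ∧ IsReflectionGroup G₂ ∧ G₁ ≠ ⊥ ∧ G₂ ≠ ⊥ ∧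
      (∀ g₁ ∈ G₁, ∀ g₂ ∈ G₂, g₁ * g₂ = g₂ * g₁) ∧ G₁ ⊓ G₂ = ⊥ ∧ G₁ ⊔ G₂ = G

/-- `G` fixes no nonzero vector. -/
def IsEssential (G : Subgroup (V ≃ₗᵢ[ℝ] V)) : Prop :=
  ∀ v : V, (∀ g ∈ G, g v = v) → v = 0

/-- The reflection arrangement of `G`: the set of its reflection hyperplanes. -/
def arrangement (G : Subgroup (V ≃ₗᵢ[ℝ] V)) : Set (Submodule ℝ V) := hyperplane '' roots G

/-- A flat: an intersection of reflection hyperplanes (the empty intersection is `V`). -/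
def IsFlat (G : Subgroup (V ≃ₗᵢ[ℝ] V)) (F : Submodule ℝ V) : Prop :=
  ∃ S ⊆ arrangement G, F = sInf S

/-- The `i`-th stratum: the set of points contained in a flat of dimension `i`. -/
def stratum (G : Subgroup (V ≃ₗᵢ[ℝ] V)) (i : ℕ) : Set V :=
  {p | ∃ F : Submodule ℝ V, IsFlat G F ∧ Module.finrank ℝ F = i ∧ p ∈ F}

/-- `p` is `G`-general: it lies on no reflection hyperplane of `G`. -/
def IsGeneral (G : Subgroup (V ≃ₗᵢ[ℝ] V)) (p : V) : Prop :=
  ∀ H ∈ arrangement G, p ∉ H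

/-- A simple system of `G`: a linearly independent set of roots such that every root is a linear
combination of its elements with all coefficients nonnegative or all coefficients nonpositive. -/
def IsSimpleSystem (G : Subgroup (V ≃ₗᵢ[ℝ] V)) (Δ : Set V) : Prop :=
  Δ ⊆ roots G ∧ LinearIndepOn ℝ id Δ ∧
    ∀ β ∈ roots G, β ∈ PointedCone.hull ℝ Δ ∨ -β ∈ PointedCone.hull ℝ Δ

/-- The labelled graph encoded by `D` is the Dynkin diagram of `G` (up to relabelling of nodes):
its nodes are in bijection with a simple system of `G`, and the label of a pair of nodes is the
order of the product of the two corresponding simple reflections. -/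
def HasDynkinDiagram (G : Subgroup (V ≃ₗᵢ[ℝ] V)) {B : Type*} (D : CoxeterMatrix B) : Prop :=
  ∃ α : B → V, Function.Injective α ∧ IsSimpleSystem G (Set.range α) ∧
    ∀ i j, D i j = orderOf (refl (α i) * refl (α j))

/-- A parabolic subgroup of `G`: one generated by the reflections in a subset of some simple
system of `G`. -/
def IsParabolic (G W : Subgroup (V ≃ₗᵢ[ℝ] V)) : Prop :=
  ∃ Δ : Set V, IsSimpleSystem G Δ ∧ ∃ I ⊆ Δ, W = Subgroup.closure (refl '' I)

end Groups

section Diagrams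

/-- The subdiagram of `D` on a set `I` of nodes, with all edges and labels inherited from `D`. -/
def subdiagram {B : Type*} (D : CoxeterMatrix B) (I : Finset B) : CoxeterMatrix I where
  M := fun i j => D i j
  isSymm := Matrix.IsSymm.ext fun i j => D.symmetric j i
  diagonal := fun i => D.diagonal i
  off_diagonal := fun i j h => D.off_diagonal i j fun h' => h (Subtype.ext h')

/-- The underlying graph of a diagram: two distinct nodes are joined by an edge unless their
label is `2`. -/
def diagramGraph {B : Type*} (D : CoxeterMatrix B) : SimpleGraph B where
  Adj i j := i ≠ j ∧ D i j ≠ 2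
  symm := ⟨fun i j h => ⟨h.1.symm, by rw [D.symmetric j i]; exact h.2⟩⟩
  loopless := ⟨fun _ h => h.1 rfl⟩

end Diagrams

end ReflGroup

end

/-!
Let `U` be the span of the roots orthogonal to `p`. It lies in the orthogonal complement of the
`k`-dimensional flat through `p`, so it has codimension at least `k`. If `L` is the span of at most
`k` simple roots and `g ∈ G`, then the parabolic subgroup generated by the `g`-images of these
simple roots has all its roots in `g L`; hence it suffices to find `g ∈ G` with `g L ∩ U = 0`.

Choose `g` so that `g L ∩ U` has minimal dimension. If it contained some `x ≠ 0`, then `g L + U`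
would be a proper subspace. By irreducibility the roots outside a proper subspace span `V`, so some
root `γ ∉ g L + U` is not orthogonal to `x`. If `y ∈ g L` is reflected in `γ` to a point of `U`,
then a multiple of `γ` lies in `g L + U`, so `y` is orthogonal to `γ` and is fixed. Reflecting
`g L` in `γ` therefore cuts the intersection down to a subspace that misses `x`.
-/

namespace ReflGroup

open Submodule Module

variable {V : Type*} [NormedAddCommGroup V] [InnerProductSpace ℝ V]
  {G : Subgroup (V ≃ₗᵢ[ℝ] V)} {R R₁ R₂ Δ I : Set V} {F L M U : Submodule ℝ V}
  {g : V ≃ₗᵢ[ℝ] V} {α β γ p v x : V}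

lemma mem_orthogonal_span {𝕜 E : Type*} [RCLike 𝕜] [NormedAddCommGroup E]
    [InnerProductSpace 𝕜 E] {s : Set E} {v : E} :
    v ∈ (span 𝕜 s)ᗮ ↔ ∀ u ∈ s, inner 𝕜 u v = 0 := by
  rw [← span_singleton_le_iff_mem, ← isOrtho_iff_le, isOrtho_comm, isOrtho_span]
  simp only [Set.mem_singleton_iff, forall_eq]

lemma mem_hyperplane : v ∈ hyperplane α ↔ inner ℝ α v = 0 :=
  mem_orthogonal_singleton_iff_inner_right

lemma refl_apply (α v : V) : refl α v = v - (2 * (inner ℝ α v / ‖α‖ ^ 2)) • α := by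
  rw [refl, reflection_orthogonal_apply, reflection_singleton_apply, RCLike.ofReal_real_eq_id, id,
    neg_sub, ofNat_smul_eq_nsmul, two_nsmul, two_mul, add_smul]

lemma refl_apply_self (α : V) : refl α α = -α :=
  reflection_orthogonalComplement_singleton_eq_neg α

lemma refl_apply_of_inner_eq_zero (h : inner ℝ α v = 0) : refl α v = v :=
  reflection_mem_subspace_eq_self (mem_hyperplane.2 h)

lemma refl_apply_mem_iff (hα : α ∈ M) : refl α v ∈ M ↔ v ∈ M := by
  rw [refl_apply, M.sub_mem_iff_left (M.smul_mem _ hα)]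

lemma mem_of_sub_refl_apply_mem (h : inner ℝ α v ≠ 0) (hv : v - refl α v ∈ M) : α ∈ M := by
  have hα : ‖α‖ ≠ 0 := norm_ne_zero_iff.2 fun h0 => h (by rw [h0, inner_zero_left])
  rw [refl_apply, sub_sub_cancel] at hv
  exact (M.smul_mem_iff (by positivity)).1 hv

lemma refl_map (g : V ≃ₗᵢ[ℝ] V) (α : V) : refl (g α) = g * refl α * g⁻¹ := by
  ext v
  obtain ⟨w, rfl⟩ := g.surjective v
  have hw : (g * refl α * g⁻¹) (g w) = g (refl α w) :=
    congrArg (fun u => g (refl α u)) (g.symm_apply_apply w)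
  rw [hw, refl_apply, refl_apply, g.inner_map_map, g.norm_map, map_sub, map_smul]

lemma commute_refl (h : inner ℝ α β = 0) : Commute (refl α) (refl β) := by
  have hconj := refl_map (refl α) β
  rw [refl_apply_of_inner_eq_zero h] at hconj
  exact (eq_mul_inv_iff_mul_eq.1 hconj).symm

lemma orderOf_refl_map_mul_refl_map (g : V ≃ₗᵢ[ℝ] V) (α β : V) :
    orderOf (refl (g α) * refl (g β)) = orderOf (refl α * refl β) := by
  have hconj : refl (g α) * refl (g β) = MulAut.conj g (refl α * refl β) := by
    rw [map_mul, MulAut.conj_apply, MulAut.conj_apply, refl_map, refl_map]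
  rw [hconj, MulEquiv.orderOf_eq]

lemma ne_zero_of_mem_roots (hα : α ∈ roots G) : α ≠ 0 :=
  ne_zero_of_norm_ne_zero (hα.1.trans_ne one_ne_zero)

lemma roots_mono {G' : Subgroup (V ≃ₗᵢ[ℝ] V)} (h : G ≤ G') : roots G ⊆ roots G' :=
  fun _ hα => ⟨hα.1, h hα.2⟩

lemma map_mem_roots (hg : g ∈ G) (hα : α ∈ roots G) : g α ∈ roots G :=
  ⟨by rw [g.norm_map, hα.1], by
    rw [refl_map]
    exact G.mul_mem (G.mul_mem hg hα.2) (G.inv_mem hg)⟩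

/-- The group generated by the reflections in the vectors of `R`. -/
def reflSubgroup (R : Set V) : Subgroup (V ≃ₗᵢ[ℝ] V) := Subgroup.closure (refl '' R)

lemma refl_mem_reflSubgroup (hα : α ∈ R) : refl α ∈ reflSubgroup R :=
  Subgroup.subset_closure (Set.mem_image_of_mem refl hα)

lemma reflSubgroup_le : reflSubgroup R ≤ G ↔ ∀ α ∈ R, refl α ∈ G := by
  rw [reflSubgroup, Subgroup.closure_le, Set.image_subset_iff]
  rfl

lemma reflSubgroup_le_of_subset_roots (hR : R ⊆ roots G) : reflSubgroup R ≤ G :=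
  reflSubgroup_le.2 fun _ hα => (hR hα).2

lemma sub_mem_span_of_mem_reflSubgroup (hg : g ∈ reflSubgroup R) (v : V) :
    g v - v ∈ span ℝ R := by
  induction hg using Subgroup.closure_induction generalizing v with
  | mem _ h =>
    obtain ⟨α, hα, rfl⟩ := h
    rw [refl_apply, sub_sub_cancel_left]
    exact neg_mem (smul_mem _ _ (subset_span hα))
  | one => exact (sub_self v).symm ▸ zero_mem _
  | mul g h _ _ ihg ihh => exact sub_add_sub_cancel (g (h v)) (h v) v ▸ add_mem (ihg _) (ihh v)
  | inv g _ ih =>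
    have h := ih (g⁻¹ v)
    rw [show g (g⁻¹ v) = v from g.apply_symm_apply v] at h
    exact neg_sub v (g⁻¹ v) ▸ neg_mem h

lemma apply_eq_self_of_mem_reflSubgroup (hg : g ∈ reflSubgroup R) (hv : v ∈ (span ℝ R)ᗮ) :
    g v = v := by
  have horth : inner ℝ v (g v - v) = 0 :=
    inner_left_of_mem_orthogonal (sub_mem_span_of_mem_reflSubgroup hg v) hv
  have hpyth := norm_add_sq_eq_norm_sq_add_norm_sq_real horth
  rw [add_sub_cancel, g.norm_map, left_eq_add, mul_self_eq_zero, norm_eq_zero] at hpyth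
  exact sub_eq_zero.1 hpyth

lemma roots_reflSubgroup_subset_span : roots (reflSubgroup R) ⊆ span ℝ R := by
  intro β hβ
  have hdiff := sub_mem_span_of_mem_reflSubgroup hβ.2 β
  refine mem_of_sub_refl_apply_mem (inner_self_ne_zero.2 (ne_zero_of_mem_roots hβ)) ?_
  rwa [← neg_sub, neg_mem_iff]

lemma isReflectionGroup_reflSubgroup (hG : (G : Set (V ≃ₗᵢ[ℝ] V)).Finite) (hR : R ⊆ roots G) :
    IsReflectionGroup (reflSubgroup R) :=
  ⟨hG.subset (reflSubgroup_le_of_subset_roots hR),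
    le_antisymm
      (Subgroup.closure_mono (Set.image_mono fun _ hα => ⟨(hR hα).1, refl_mem_reflSubgroup hα⟩))
      (reflSubgroup_le_of_subset_roots subset_rfl)⟩

lemma reflSubgroup_ne_bot (hα : α ∈ R) (h0 : α ≠ 0) : reflSubgroup R ≠ ⊥ := by
  intro hbot
  have hone : refl α = 1 := (Subgroup.eq_bot_iff_forall _).1 hbot _ (refl_mem_reflSubgroup hα)
  have := IsAddTorsionFree.of_isTorsionFree ℝ V
  exact h0 (self_eq_neg.1 ((congrArg (· α) hone).symm.trans (refl_apply_self α)))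

lemma reflSubgroup_union :
    reflSubgroup (R₁ ∪ R₂) = reflSubgroup R₁ ⊔ reflSubgroup R₂ := by
  rw [reflSubgroup, Set.image_union, Subgroup.closure_union, reflSubgroup, reflSubgroup]

lemma commute_of_mem_reflSubgroup (h : span ℝ R₁ ⟂ span ℝ R₂) {g₁ g₂ : V ≃ₗᵢ[ℝ] V}
    (h₁ : g₁ ∈ reflSubgroup R₁) (h₂ : g₂ ∈ reflSubgroup R₂) : Commute g₁ g₂ := by
  have hle : reflSubgroup R₁ ≤ Subgroup.centralizer (reflSubgroup R₂) := by
    rw [reflSubgroup_le, reflSubgroup, Subgroup.centralizer_closure]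
    rintro α hα _ ⟨β, hβ, rfl⟩
    exact (commute_refl (isOrtho_span.1 h hα hβ)).eq.symm
  exact (Subgroup.mem_centralizer_iff.1 (hle h₁) g₂ h₂).symm

lemma reflSubgroup_inf_eq_bot (h : Disjoint (span ℝ R₁) (span ℝ R₂)) :
    reflSubgroup R₁ ⊓ reflSubgroup R₂ = ⊥ := by
  rw [Subgroup.eq_bot_iff_forall]
  rintro g ⟨h₁, h₂⟩
  ext v
  exact sub_eq_zero.1 (disjoint_def.1 h _ (sub_mem_span_of_mem_reflSubgroup h₁ v)
    (sub_mem_span_of_mem_reflSubgroup h₂ v))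

lemma IsIrreducible.eq_empty_or_eq_empty (hirr : IsIrreducible G) (hG : IsReflectionGroup G)
    (hR : R₁ ∪ R₂ = roots G) (h : span ℝ R₁ ⟂ span ℝ R₂) : R₁ = ∅ ∨ R₂ = ∅ := by
  by_contra! hne
  obtain ⟨⟨α, hα⟩, ⟨β, hβ⟩⟩ := hne
  have hR₁ : R₁ ⊆ roots G := hR ▸ Set.subset_union_left
  have hR₂ : R₂ ⊆ roots G := hR ▸ Set.subset_union_right
  refine hirr ⟨reflSubgroup R₁, reflSubgroup R₂,
    isReflectionGroup_reflSubgroup hG.1 hR₁, isReflectionGroup_reflSubgroup hG.1 hR₂,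
    reflSubgroup_ne_bot hα (ne_zero_of_mem_roots (hR₁ hα)),
    reflSubgroup_ne_bot hβ (ne_zero_of_mem_roots (hR₂ hβ)),
    fun g₁ h₁ g₂ h₂ => commute_of_mem_reflSubgroup h h₁ h₂,
    reflSubgroup_inf_eq_bot h.disjoint, ?_⟩
  rw [← reflSubgroup_union, hR]
  exact hG.2.symm

lemma mem_span_roots_diff_or_mem_orthogonal (M : Submodule ℝ V) (hα : α ∈ roots G) :
    α ∈ span ℝ (roots G \ M) ∨ α ∈ (span ℝ (roots G \ M))ᗮ := by
  by_cases hαM : α ∈ M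
  · refine or_iff_not_imp_right.2 fun hnot => ?_
    obtain ⟨γ, hγ, hne⟩ : ∃ γ ∈ roots G \ M, inner ℝ γ α ≠ 0 := by
      by_contra! hortho
      exact hnot (mem_orthogonal_span.2 hortho)
    rw [real_inner_comm] at hne
    have hreflγ : refl α γ ∈ roots G \ M :=
      ⟨map_mem_roots hα.2 hγ.1, fun h => hγ.2 ((refl_apply_mem_iff hαM).1 h)⟩
    exact mem_of_sub_refl_apply_mem hne (sub_mem (subset_span hγ) (subset_span hreflγ))
  · exact Or.inl (subset_span ⟨hα, hαM⟩)

lemma IsIrreducible.span_roots_diff (hirr : IsIrreducible G) (hG : IsReflectionGroup G)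
    (hM : ¬ roots G ⊆ M) : span ℝ (roots G \ M) = span ℝ (roots G) := by
  set N := span ℝ (roots G \ M)
  obtain ⟨α, hα, hαM⟩ := Set.not_subset.1 hM
  have hcover : roots G ∩ N ∪ roots G ∩ Nᗮ = roots G := by
    rw [← Set.inter_union_distrib_left]
    exact Set.inter_eq_left.2 fun _ => mem_span_roots_diff_or_mem_orthogonal M
  have hortho : span ℝ (roots G ∩ N) ⟂ span ℝ (roots G ∩ Nᗮ) :=
    isOrtho_span.2 fun _ hu _ hv => inner_right_of_mem_orthogonal hu.2 hv.2
  have hempty : roots G ∩ (Nᗮ : Submodule ℝ V) = ∅ :=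
    (hirr.eq_empty_or_eq_empty hG hcover hortho).resolve_left
      (Set.nonempty_iff_ne_empty.1 ⟨α, hα, subset_span ⟨hα, hαM⟩⟩)
  refine le_antisymm (span_mono Set.sdiff_subset) (span_le.2 ?_)
  rw [hempty, Set.union_empty] at hcover
  exact Set.inter_eq_left.1 hcover

lemma IsEssential.span_roots_eq_top [FiniteDimensional ℝ V] (hess : IsEssential G)
    (hG : IsReflectionGroup G) : span ℝ (roots G) = ⊤ := by
  rw [← orthogonal_eq_bot_iff, Submodule.eq_bot_iff]
  exact fun v hv => hess v fun g hg => apply_eq_self_of_mem_reflSubgroup (hG.2.le hg) hv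

lemma exists_mem_roots_diff_inner_ne_zero [FiniteDimensional ℝ V] (hG : IsReflectionGroup G)
    (hirr : IsIrreducible G) (hess : IsEssential G) (hM : M ≠ ⊤) (hx : x ≠ 0) :
    ∃ γ ∈ roots G \ M, inner ℝ γ x ≠ 0 := by
  have hroots : ¬ roots G ⊆ M := by
    rwa [← span_le, hess.span_roots_eq_top hG, top_le_iff]
  by_contra! hortho
  have hx' : x ∈ (span ℝ (roots G \ M))ᗮ := mem_orthogonal_span.2 hortho
  rw [hirr.span_roots_diff hG hroots, hess.span_roots_eq_top hG, top_orthogonal_eq_bot] at hx'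
  exact hx hx'

lemma map_refl_inf_lt (hγ : γ ∉ L ⊔ U) (hx : x ∈ L ⊓ U) (hγx : inner ℝ γ x ≠ 0) :
    L.map (refl γ).toLinearMap ⊓ U < L ⊓ U := by
  have hfixed : ∀ v ∈ L.map (refl γ).toLinearMap ⊓ U, v ∈ L ⊓ U ∧ inner ℝ γ v = 0 := by
    rintro _ ⟨⟨y, hyL, rfl⟩, hyU⟩
    change refl γ y ∈ U at hyU
    have hγy : inner ℝ γ y = 0 := by
      by_contra hne
      exact hγ (mem_of_sub_refl_apply_mem hne (sub_mem (mem_sup_left hyL) (mem_sup_right hyU)))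
    change refl γ y ∈ L ⊓ U ∧ inner ℝ γ (refl γ y) = 0
    rw [refl_apply_of_inner_eq_zero hγy] at hyU ⊢
    exact ⟨⟨hyL, hyU⟩, hγy⟩
  exact SetLike.lt_iff_le_and_exists.2
    ⟨fun v hv => (hfixed v hv).1, x, hx, fun h => hγx (hfixed x h).2⟩

lemma exists_map_inf_eq_bot [FiniteDimensional ℝ V] (hG : IsReflectionGroup G)
    (hirr : IsIrreducible G) (hess : IsEssential G)
    (hdim : finrank ℝ L + finrank ℝ U ≤ finrank ℝ V) :
    ∃ g ∈ G, L.map g.toLinearMap ⊓ U = ⊥ := by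
  obtain ⟨g, hg, hmin⟩ := Set.exists_min_image (G : Set (V ≃ₗᵢ[ℝ] V))
    (fun g => finrank ℝ (L.map g.toLinearMap ⊓ U : Submodule ℝ V)) hG.1 ⟨1, G.one_mem⟩
  refine ⟨g, hg, ?_⟩
  by_contra hbot
  have hproper : L.map g.toLinearMap ⊔ U ≠ ⊤ := fun htop => by
    have hsum := finrank_sup_add_finrank_inf_eq (L.map g.toLinearMap) U
    rw [htop, finrank_top, show finrank ℝ (L.map g.toLinearMap) = finrank ℝ L from
      g.toLinearEquiv.finrank_map_eq L] at hsum
    exact hbot (finrank_eq_zero.1 (by lia))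
  obtain ⟨x, hx, hx0⟩ := exists_mem_ne_zero_of_ne_bot hbot
  obtain ⟨γ, hγ, hγx⟩ := exists_mem_roots_diff_inner_ne_zero hG hirr hess hproper hx0
  have hmap : L.map (refl γ * g).toLinearMap = (L.map g.toLinearMap).map (refl γ).toLinearMap :=
    L.map_comp g.toLinearMap (refl γ).toLinearMap
  refine (hmin (refl γ * g) (G.mul_mem hγ.1.2 hg)).not_gt ?_
  rw [hmap]
  exact finrank_lt_finrank_of_lt (map_refl_inf_lt hγ.2 hx hγx)

/-- The roots of `G` whose hyperplanes contain `p`, that is, the roots of the stabilizer of `p`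
in `G`. -/
def rootsAt (G : Subgroup (V ≃ₗᵢ[ℝ] V)) (p : V) : Set V := {β ∈ roots G | p ∈ hyperplane β}

lemma exists_isGeneral_reflSubgroup_image [FiniteDimensional ℝ V] (hG : IsReflectionGroup G)
    (hirr : IsIrreducible G) (hess : IsEssential G) (hR : R ⊆ roots G)
    (hdim : finrank ℝ (span ℝ R) + finrank ℝ (span ℝ (rootsAt G p)) ≤ finrank ℝ V) :
    ∃ g ∈ G, IsGeneral (reflSubgroup (g '' R)) p := by
  obtain ⟨g, hg, hbot⟩ := exists_map_inf_eq_bot hG hirr hess hdim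
  refine ⟨g, hg, ?_⟩
  rintro _ ⟨β, hβ, rfl⟩ hpβ
  have hβL : β ∈ (span ℝ R).map g.toLinearMap := by
    rw [Submodule.map_span]
    exact roots_reflSubgroup_subset_span hβ
  have hle : reflSubgroup (g '' R) ≤ G :=
    reflSubgroup_le_of_subset_roots (Set.image_subset_iff.2 fun _ hα => map_mem_roots hg (hR hα))
  have hβ0 : β ∈ (⊥ : Submodule ℝ V) :=
    hbot ▸ ⟨hβL, subset_span ⟨roots_mono hle hβ, hpβ⟩⟩
  exact ne_zero_of_mem_roots hβ hβ0

lemma IsFlat.inf_hyperplane (hF : IsFlat G F) (hβ : β ∈ roots G) :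
    IsFlat G (F ⊓ hyperplane β) := by
  obtain ⟨S, hS, rfl⟩ := hF
  refine ⟨insert (hyperplane β) S, Set.insert_subset ⟨β, hβ, rfl⟩ hS, ?_⟩
  rw [sInf_insert, inf_comm]

lemma finrank_inf_hyperplane_add_one [FiniteDimensional ℝ F] (hβ : β ∉ Fᗮ) :
    finrank ℝ (F ⊓ hyperplane β : Submodule ℝ V) + 1 = finrank ℝ F := by
  let f : Dual ℝ F := (innerₛₗ ℝ β).domRestrict F
  have hker : f.ker = (hyperplane β).comap F.subtype := by
    ext v
    exact mem_hyperplane.symm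
  have hf : f ≠ 0 := fun h0 => hβ fun v hv =>
    (real_inner_comm v β).symm.trans (LinearMap.congr_fun h0 ⟨v, hv⟩)
  rw [← map_comap_subtype, finrank_map_subtype_eq, ← hker]
  exact Dual.finrank_ker_add_one_of_ne_zero hf

lemma rootsAt_subset_orthogonal {k : ℕ} [FiniteDimensional ℝ F] (hF : IsFlat G F)
    (hk : finrank ℝ F = k + 1) (hpF : p ∈ F) (hp : p ∉ stratum G k) : rootsAt G p ⊆ Fᗮ := by
  intro β hβ
  by_contra hβF
  have hdim := finrank_inf_hyperplane_add_one hβF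
  exact hp ⟨_, hF.inf_hyperplane hβ.1, by lia, hpF, hβ.2⟩

lemma add_finrank_span_rootsAt_le [FiniteDimensional ℝ V] {k : ℕ}
    (hp : p ∈ stratum G (k + 1) \ stratum G k) :
    k + 1 + finrank ℝ (span ℝ (rootsAt G p)) ≤ finrank ℝ V := by
  obtain ⟨⟨F, hF, hk, hpF⟩, hp'⟩ := hp
  rw [← F.finrank_add_finrank_orthogonal, hk]
  gcongr
  exact finrank_mono (span_le.2 (rootsAt_subset_orthogonal hF hk hpF hp'))

section PointedCone

variable {𝕜 E E' : Type*} [Ring 𝕜] [PartialOrder 𝕜] [IsOrderedRing 𝕜] [AddCommGroup E]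
  [Module 𝕜 E] [AddCommGroup E'] [Module 𝕜 E'] {s t : Set E} {x : E}

lemma mem_hull_of_mem_span (hs : LinearIndepOn 𝕜 id s) (hts : t ⊆ s)
    (hx : x ∈ PointedCone.hull 𝕜 s) (hxt : x ∈ span 𝕜 t) : x ∈ PointedCone.hull 𝕜 t := by
  rw [← Set.union_sdiff_cancel hts, PointedCone.hull, span_union, mem_sup] at hx
  obtain ⟨y, hy, z, hz, rfl⟩ := hx
  have hzt : z ∈ span 𝕜 t :=
    ((span 𝕜 t).add_mem_iff_right (PointedCone.hull_le_span 𝕜 t hy)).1 hxt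
  have hdisj : Disjoint (span 𝕜 t) (span 𝕜 (s \ t)) := by
    rw [← Set.union_sdiff_cancel hts] at hs
    exact ((linearIndepOn_id_union_iff Set.disjoint_sdiff_right).1 hs).2.2
  have hz0 : z = 0 := disjoint_def.1 hdisj z hzt (PointedCone.hull_le_span 𝕜 _ hz)
  rwa [hz0, add_zero]

lemma map_mem_hull_image (f : E →ₗ[𝕜] E') (hx : x ∈ PointedCone.hull 𝕜 s) :
    f x ∈ PointedCone.hull 𝕜 (f '' s) :=
  apply_mem_span_image_of_mem_span (f.restrictScalars {c : 𝕜 // 0 ≤ c}) hx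

end PointedCone

lemma IsSimpleSystem.reflSubgroup_of_subset (hΔ : IsSimpleSystem G Δ) (hI : I ⊆ Δ) :
    IsSimpleSystem (reflSubgroup I) I := by
  refine ⟨fun α hα => ⟨(hΔ.1 (hI hα)).1, refl_mem_reflSubgroup hα⟩, hΔ.2.1.mono hI,
    fun β hβ => ?_⟩
  have hβI : β ∈ span ℝ I := roots_reflSubgroup_subset_span hβ
  have hβG : β ∈ roots G :=
    roots_mono (reflSubgroup_le_of_subset_roots (hI.trans hΔ.1)) hβ
  exact (hΔ.2.2 β hβG).imp (fun h => mem_hull_of_mem_span hΔ.2.1 hI h hβI)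
    fun h => mem_hull_of_mem_span hΔ.2.1 hI h (neg_mem hβI)

lemma IsSimpleSystem.image (hΔ : IsSimpleSystem G Δ) (hg : g ∈ G) :
    IsSimpleSystem G (g '' Δ) := by
  refine ⟨Set.image_subset_iff.2 fun α hα => map_mem_roots hg (hΔ.1 hα),
    LinearIndepOn.id_image
      (LinearIndependent.map' hΔ.2.1 g.toLinearMap (LinearMap.ker_eq_bot.2 g.injective)),
    fun β hβ => ?_⟩
  have hβ' := hΔ.2.2 (g⁻¹ β) (map_mem_roots (G.inv_mem hg) hβ)
  rw [← map_neg] at hβ'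
  have himage : ∀ x, g⁻¹ x ∈ PointedCone.hull ℝ Δ → x ∈ PointedCone.hull ℝ (g '' Δ) :=
    fun x hx => g.apply_symm_apply x ▸ map_mem_hull_image g.toLinearMap hx
  exact hβ'.imp (himage β) (himage (-β))

lemma hasDynkinDiagram_subdiagram {B : Type*} {D : CoxeterMatrix B} {α : B → V}
    (hα : Function.Injective α) (hΔ : IsSimpleSystem G (Set.range α))
    (hD : ∀ i j, D i j = orderOf (refl (α i) * refl (α j))) (I : Finset B) :
    HasDynkinDiagram (reflSubgroup (α '' I)) (subdiagram D I) := by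
  refine ⟨fun i => α i, hα.comp Subtype.val_injective, ?_, fun i j => hD i j⟩
  have hrange : Set.range (fun i : I => α i) = α '' I := Set.image_eq_range α I |>.symm
  rw [hrange]
  exact hΔ.reflSubgroup_of_subset (Set.image_subset_range α I)

end ReflGroup

theorem proposition5p2_general
    {V : Type*} [NormedAddCommGroup V] [InnerProductSpace ℝ V] [FiniteDimensional ℝ V]
    (G : Subgroup (V ≃ₗᵢ[ℝ] V))
    (hG : ReflGroup.IsReflectionGroup G)
    (hirr : ReflGroup.IsIrreducible G)
    (hess : ReflGroup.IsEssential G)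
    {B : Type*} (D : CoxeterMatrix B) (hD : ReflGroup.HasDynkinDiagram G D)
    (k : ℕ) (p : V) (hp : p ∈ ReflGroup.stratum G (k + 1) \ ReflGroup.stratum G k)
    (I : Finset B) (hcard : I.card ≤ k + 1) :
    ∃ W : Subgroup (V ≃ₗᵢ[ℝ] V),
      ReflGroup.IsParabolic G W ∧
      ReflGroup.HasDynkinDiagram W (ReflGroup.subdiagram D I) ∧
      ReflGroup.IsGeneral W p := by
  classical
  obtain ⟨α, hα, hΔ, hD⟩ := hD
  have hI : α '' I ⊆ Set.range α := Set.image_subset_range α I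
  have hspan : Module.finrank ℝ (Submodule.span ℝ (α '' I)) ≤ k + 1 := by
    rw [← Finset.coe_image]
    exact (finrank_span_finset_le_card (I.image α)).trans (Finset.card_image_le.trans hcard)
  have hdim := (Nat.add_le_add_right hspan _).trans (ReflGroup.add_finrank_span_rootsAt_le hp)
  obtain ⟨g, hg, hgeneral⟩ :=
    ReflGroup.exists_isGeneral_reflSubgroup_image hG hirr hess (hI.trans hΔ.1) hdim
  have hgΔ := hΔ.image hg
  refine ⟨_, ⟨g '' Set.range α, hgΔ, g '' (α '' I), Set.image_mono hI, rfl⟩, ?_, hgeneral⟩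
  rw [← Set.range_comp] at hgΔ
  rw [← Set.image_comp g α I]
  exact ReflGroup.hasDynkinDiagram_subdiagram (g.injective.comp hα) hgΔ
    (fun i j => (hD i j).trans (ReflGroup.orderOf_refl_map_mul_refl_map g _ _).symm) I

theorem proposition5p2
    {V : Type*} [NormedAddCommGroup V] [InnerProductSpace ℝ V] [FiniteDimensional ℝ V]
    (G : Subgroup (V ≃ₗᵢ[ℝ] V))
    (hG : ReflGroup.IsReflectionGroup G)
    (hirr : ReflGroup.IsIrreducible G)
    (hess : ReflGroup.IsEssential G)
    {B : Type*} (D : CoxeterMatrix B) (hD : ReflGroup.HasDynkinDiagram G D)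
    (k : ℕ) (hk : 1 ≤ k)
    (p : V) (hp : p ∈ ReflGroup.stratum G k \ ReflGroup.stratum G (k - 1))
    (I : Finset B) (hcard : I.card = k)
    (hconn : (ReflGroup.diagramGraph (ReflGroup.subdiagram D I)).Connected) :
    ∃ W : Subgroup (V ≃ₗᵢ[ℝ] V),
      ReflGroup.IsParabolic G W ∧
      ReflGroup.HasDynkinDiagram W (ReflGroup.subdiagram D I) ∧
      ReflGroup.IsGeneral W p := by
  obtain ⟨k, rfl⟩ := Nat.exists_eq_add_of_le' hk
  exact proposition5p2_general G hG hirr hess D hD k p hp I hcard.le
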